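/- A nondeterministic input-driven double-head pushdown automaton is a system $M=\langle Q,\Sigma,\Gamma,q_0,F,\bot,\delta_D,\delta_R,\delta_N\rangle$ with a finite set of states $Q$, a finite input alphabet $\Sigma$ partitioned into (possibly empty) sets $\Sigma_D,\Sigma_R,\Sigma_N$, a finite pushdown alphabet $\Gamma$, an initial state $q_0\in Q$, a set $F\subseteq Q$ of accepting states, an empty-pushdown symbol $\bot\notin\Gamma$, and partial transition functions $\delta_D$ from $Q\times(\Sigma_D\cup\{\lambda\})^2\times(\Gamma\cup\{\bot\})$ to $2^{Q\times\Gamma}$, and, for $X\in\{R,N\}$, $\delta_X$ from $Q\times(\Sigma_X\cup\{\lambda\})^2\times(\Gamma\cup\{\bot\})$ to $2^{Q}$, each defined only where exactly one of the second and third arguments is the empty word $\lambda$. A configuration is a triple $(q,w,s)\in Q\times\Sigma^*\times\Gamma^*$ (state, unread input, pushdown content with the top leftmost). In one step, $M$ reads and removes either the first symbol $a$ of the unread input (transition arguments $(q,a,\lambda,z)$) or its last symbol $a$ (arguments $(q,\lambda,a,z)$), where $z$ is the topmost symbol of $s$, or $\bot$ if $s=\lambda$. If $a\in\Sigma_D$,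 it goes to state $q'$ and pushes $z'$ for some $(q',z')$ in the value of $\delta_D$; if $a\in\Sigma_R$, it goes to some $q'$ in the value of $\delta_R$ and pops the topmost symbol (the empty pushdown stays empty); if $a\in\Sigma_N$, it goes to some $q'$ in the value of $\delta_N$ and leaves $s$ unchanged. The accepted language $L(M)$ is the set of all $w\in\Sigma^*$ for which some finite sequence of steps leads from $(q_0,w,\lambda)$ to $(q,\lambda,s)$ with $q\in F$ and $s\in\Gamma^*$. Call a decision problem semidecidable if the set of (finitely encoded) instances with answer ``yes'' is recursively enumerable. Theorem. None of the following problems is semidecidable: 1. (Universality) Given a nondeterministic input-driven double-head pushdown automaton $M$ with input alphabet $\Sigma$, is $L(M)=\Sigma^*$? 2. (Equivalence) Given two nondeterministic input-driven double-head pushdown automata $M_1,M_2$, do they have the same input alphabet and satisfy $L(M_1)=L(M_2)$? 3. (Regularity) Given a nondeterministic input-driven double-head pushdown automaton $M$, is $L(M)$ a regular language? -/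

import Mathlib

/-- The three actions on the pushdown store: push (`D`), pop (`R`), state change only (`N`). -/
inductive PushdownAction
  | push
  | pop
  | neutral
  deriving DecidableEq

/-- The two input heads. -/
inductive InputHead
  | left
  | right
  deriving DecidableEq

/-- A nondeterministic input-driven double-head pushdown automaton with state set `Q`, input
alphabet `A` and pushdown alphabet `Γ` (all three are finite in every use below).

* `signature` is the partition of `A` into the symbols that force a push, a pop, or a state change
  only; the blocks may be empty.
* Exactly one head reads a symbol in each step: `δ q .left a z` is the value of the transition
  function at `(q, a, λ, z)`, and `δ q .right a z` is its value at `(q, λ, a, z)`.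
* The fourth argument is the topmost pushdown symbol, with `none` for the empty pushdown symbol `⊥`.
* Where a partial transition function is undefined, its value is the empty set. -/
structure NIDDHPDA (Q A Γ : Type*) where
  signature : A → PushdownAction
  init : Q
  accept : Set Q
  pushStep : Q → InputHead → {a : A // signature a = .push} → Option Γ → Set (Q × Γ)
  popStep : Q → InputHead → {a : A // signature a = .pop} → Option Γ → Set Q
  neutralStep : Q → InputHead → {a : A // signature a = .neutral} → Option Γ → Set Q

namespace NIDDHPDA

variable {Q A Γ : Type*}

/-- One computation step between configurations `(q, w, s)`: the current state, the unread part of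
the input, and the pushdown content with its top leftmost. The topmost symbol is `s.head?`, and
`s.tail` is the content after a pop (the empty store stays empty). -/
inductive Step (M : NIDDHPDA Q A Γ) : Q × List A × List Γ → Q × List A × List Γ → Prop
  | push_left {q q' : Q} {a : A} {w : List A} {s : List Γ} {z' : Γ}
      (ha : M.signature a = .push) (h : (q', z') ∈ M.pushStep q .left ⟨a, ha⟩ s.head?) :
      Step M (q, a :: w, s) (q', w, z' :: s)
  | push_right {q q' : Q} {a : A} {w : List A} {s : List Γ} {z' : Γ}
      (ha : M.signature a = .push) (h : (q', z') ∈ M.pushStep q .right ⟨a, ha⟩ s.head?) :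
      Step M (q, w ++ [a], s) (q', w, z' :: s)
  | pop_left {q q' : Q} {a : A} {w : List A} {s : List Γ}
      (ha : M.signature a = .pop) (h : q' ∈ M.popStep q .left ⟨a, ha⟩ s.head?) :
      Step M (q, a :: w, s) (q', w, s.tail)
  | pop_right {q q' : Q} {a : A} {w : List A} {s : List Γ}
      (ha : M.signature a = .pop) (h : q' ∈ M.popStep q .right ⟨a, ha⟩ s.head?) :
      Step M (q, w ++ [a], s) (q', w, s.tail)
  | neutral_left {q q' : Q} {a : A} {w : List A} {s : List Γ}
      (ha : M.signature a = .neutral) (h : q' ∈ M.neutralStep q .left ⟨a, ha⟩ s.head?) :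
      Step M (q, a :: w, s) (q', w, s)
  | neutral_right {q q' : Q} {a : A} {w : List A} {s : List Γ}
      (ha : M.signature a = .neutral) (h : q' ∈ M.neutralStep q .right ⟨a, ha⟩ s.head?) :
      Step M (q, w ++ [a], s) (q', w, s)

/-- The accepted language: the words on which some computation from the initial configuration reads
the whole input and ends in an accepting state, with any pushdown content. -/
def accepts (M : NIDDHPDA Q A Γ) : Language A :=
  {w | ∃ q ∈ M.accept, ∃ s : List Γ, Relation.ReflTransGen M.Step (M.init, w, []) (q, [], s)}

end NIDDHPDA

/-- `PushdownAction` has three elements. -/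
def PushdownAction.equivFin : PushdownAction ≃ Fin 3 where
  toFun
    | .push => 0
    | .pop => 1
    | .neutral => 2
  invFun
    | 0 => .push
    | 1 => .pop
    | 2 => .neutral
  left_inv x := by cases x <;> rfl
  right_inv x := by fin_cases x <;> rfl

/-- `InputHead` has two elements. -/
def InputHead.equivBool : InputHead ≃ Bool where
  toFun
    | .left => false
    | .right => true
  invFun
    | false => .left
    | true => .right
  left_inv x := by cases x <;> rfl
  right_inv x := by cases x <;> rfl

instance : Primcodable PushdownAction := Primcodable.ofEquiv (Fin 3) PushdownAction.equivFin

instance : Primcodable InputHead := Primcodable.ofEquiv Bool InputHead.equivBool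

/-- A finite description of a nondeterministic input-driven double-head pushdown automaton, as it is
given to an algorithm. The states are `0, …, lastState`, the input symbols are
`0, …, numSymbols - 1`, and the pushdown symbols are `0, …, numStack - 1`. The signature is listed
symbol by symbol, the accepting states are listed, and each transition function is given by the list
of its entries `(q, head, a, z, q', z')` or `(q, head, a, z, q')`. -/
structure NIDDHPDACode where
  lastState : ℕ
  numSymbols : ℕ
  numStack : ℕ
  signature : List PushdownAction
  init : ℕ
  accept : List ℕ
  pushes : List (ℕ × InputHead × ℕ × Option ℕ × ℕ × ℕ)
  pops : List (ℕ × InputHead × ℕ × Option ℕ × ℕ)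
  neutrals : List (ℕ × InputHead × ℕ × Option ℕ × ℕ)

namespace NIDDHPDACode

/-- A description as a tuple of its components. -/
def equivTuple : NIDDHPDACode ≃
    ℕ × ℕ × ℕ × List PushdownAction × ℕ × List ℕ ×
      List (ℕ × InputHead × ℕ × Option ℕ × ℕ × ℕ) ×
      List (ℕ × InputHead × ℕ × Option ℕ × ℕ) × List (ℕ × InputHead × ℕ × Option ℕ × ℕ) where
  toFun c := (c.lastState, c.numSymbols, c.numStack, c.signature, c.init, c.accept, c.pushes,
    c.pops, c.neutrals)
  invFun t := ⟨t.1, t.2.1, t.2.2.1, t.2.2.2.1, t.2.2.2.2.1, t.2.2.2.2.2.1, t.2.2.2.2.2.2.1,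
    t.2.2.2.2.2.2.2.1, t.2.2.2.2.2.2.2.2⟩
  left_inv _ := rfl
  right_inv _ := rfl

instance : Primcodable NIDDHPDACode := Primcodable.ofEquiv _ equivTuple

/-- The automaton that a description denotes. So that every description denotes an automaton, a
symbol without an entry in the signature list is neutral, the initial state is read modulo the
number of states, and list entries that mention a number out of range have no effect. -/
def toNIDDHPDA (c : NIDDHPDACode) :
    NIDDHPDA (Fin (c.lastState + 1)) (Fin c.numSymbols) (Fin c.numStack) where
  signature a := c.signature[a.val]?.getD .neutral
  init := Fin.ofNat (c.lastState + 1) c.init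
  accept := {q | q.val ∈ c.accept}
  pushStep q d a z :=
    {p | (q.val, d, a.val.val, z.map Fin.val, p.1.val, p.2.val) ∈ c.pushes}
  popStep q d a z := {q' | (q.val, d, a.val.val, z.map Fin.val, q'.val) ∈ c.pops}
  neutralStep q d a z := {q' | (q.val, d, a.val.val, z.map Fin.val, q'.val) ∈ c.neutrals}

/-- The language accepted by the described automaton. -/
def language (c : NIDDHPDACode) : Language (Fin c.numSymbols) := c.toNIDDHPDA.accepts

/-- `L(M) = Σ*`. -/
def Universal (c : NIDDHPDACode) : Prop := ∀ w : List (Fin c.numSymbols), w ∈ c.language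

/-- The two automata have the same input alphabet and `L(M₁) = L(M₂)`. -/
def Equivalent (c₁ c₂ : NIDDHPDACode) : Prop :=
  ∃ h : c₁.numSymbols = c₂.numSymbols,
    ∀ w : List (Fin c₁.numSymbols), w ∈ c₁.language ↔ w.map (Fin.cast h) ∈ c₂.language

/-- `L(M)` is a regular language. -/
def Regular (c : NIDDHPDACode) : Prop := c.language.IsRegular

end NIDDHPDACode

/-! The pushdown store is not needed: every automaton built below has only neutral symbols, and the
undecidability comes from the two heads. A queue machine with initial queue `w` halts exactly if
some word `x`, consisting of the letters it removes, satisfies `x = w ++ output x`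
(`QueueMachine.eval_dom_iff`). Such a fixed point is encoded as `x # xᴿ`. A word is an encoding iff
it has both the form `x # xᴿ` and the form `x # (w ++ output x)ᴿ`. Each form is checked by a
deterministic device whose left head walks through `x` while the right head compares the pending
output letters. The state determines the reading head, so accepting everywhere except in `done`
gives the complement. One device starts with the left head, the other with the right, so a
nondeterministic first move yields the union of the complements (`TwoHead.mem_acceptsFrom_choice`).
The resulting automaton rejects only encodings of fixed points and is universal iff the machine does
not halt.

For regularity, a padding letter makes the set of fixed points infinite once it is nonempty, and
then the language is not regular (`TwoHead.not_isRegular`). For equivalence, the automata are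
compared with one fixed universal member of the family.

Queue machines are strong enough because they can rotate through the four stacks of a machine that
computes a partial recursive function (`StackQueue.respects`). One queue machine serves all
programs: program number `m` enters as the input `2 ^ (m + 1)`, so only a chain of states that
counts down letters depends on `m`, and the reduction is computable (`TwoHead.exists_reduction`). -/

/-! ### Deterministic queue machines -/

namespace QueueMachine

open StateTransition

variable {S B : Type*}

/-- One step of the queue machine with transition function `δ`: in state `s`, the first letter `a`
of the queue is removed and the letters `(δ s a).2` are appended at its end. The machine halts when
the queue is empty. -/
def step (δ : S → B → S × List B) : S × List B → Option (S × List B)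
  | (_, []) => none
  | (s, a :: w) => some ((δ s a).1, w ++ (δ s a).2)

/-- The letters appended to the queue while the letters of a word are removed. -/
def output (δ : S → B → S × List B) : S → List B → List B
  | _, [] => []
  | s, a :: x => (δ s a).2 ++ output δ (δ s a).1 x

/-- The state that is reached after the letters of a word are removed. -/
def final (δ : S → B → S × List B) : S → List B → S
  | s, [] => s
  | s, a :: x => final δ (δ s a).1 x

theorem output_append (δ : S → B → S × List B) (s : S) (x y : List B) :
    output δ s (x ++ y) = output δ s x ++ output δ (final δ s x) y := by
  induction x generalizing s with
  | nil => rfl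
  | cons a x ih => simp [output, final, ih]

theorem step_eq_none {δ : S → B → S × List B} {c : S × List B} : step δ c = none ↔ c.2 = [] := by
  rcases c with ⟨s, _ | ⟨a, w⟩⟩ <;> simp [step]

/-- A queue machine halts if and only if the letters that it removes are exactly the letters of the
initial queue followed by the letters that it appends. -/
theorem eval_dom_iff (δ : S → B → S × List B) (s : S) (w : List B) :
    (eval (step δ) (s, w)).Dom ↔ ∃ x, w ++ output δ s x = x := by
  constructor
  · intro h
    obtain ⟨c, hc⟩ := Part.dom_iff_mem.1 h
    obtain ⟨hr, hn⟩ := mem_eval.1 hc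
    clear hc h
    generalize hd : (s, w) = d at hr
    induction hr using Relation.ReflTransGen.head_induction_on generalizing s w with
    | refl =>
      subst hd
      exact ⟨[], by simpa [step_eq_none, output] using hn⟩
    | head h1 _ ih =>
      subst hd
      rcases w with _ | ⟨a, w⟩
      · simp [step] at h1
      · simp only [step, Option.mem_def, Option.some.injEq] at h1
        obtain ⟨x, hx⟩ := ih _ _ h1
        exact ⟨a :: x, by simpa [output] using hx⟩
  · rintro ⟨x, hx⟩
    induction x generalizing s w with
    | nil =>
      have hw : w = [] := (List.append_eq_nil_iff.1 hx).1
      subst hw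
      exact Part.dom_iff_mem.2 ⟨(s, []), mem_eval.2 ⟨.refl, rfl⟩⟩
    | cons a x ih =>
      rcases w with _ | ⟨b, w⟩
      -- A fixed point may be longer than the run: here the queue is already empty, and the rest of
      -- `x` is irrelevant.
      · exact Part.dom_iff_mem.2 ⟨(s, []), mem_eval.2 ⟨.refl, rfl⟩⟩
      · simp only [List.cons_append, List.cons.injEq, output] at hx
        obtain ⟨rfl, hx⟩ := hx
        have := ih (δ s b).1 (w ++ (δ s b).2) (by rw [List.append_assoc, hx])
        rwa [reaches_eval (f := step δ) (a := (s, b :: w)) (b := ((δ s b).1, w ++ (δ s b).2))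
        (.single rfl)]

/-! ### Padding: from one fixed point to infinitely many -/

/-- The machine with an additional letter `none` that is moved from the front of the queue to its
end. -/
def pad (δ : S → B → S × List B) : S → Option B → S × List (Option B)
  | s, none => (s, [none])
  | s, some a => ((δ s a).1, (δ s a).2.map some)

theorem output_pad_map (δ : S → B → S × List B) (s : S) (x : List B) :
    output (pad δ) s (x.map some) = (output δ s x).map some := by
  induction x generalizing s with
  | nil => rfl
  | cons a x ih => simp [output, pad, ih]

theorem output_pad_replicate (δ : S → B → S × List B) (s : S) (j : ℕ) :
    output (pad δ) s (List.replicate j none) = List.replicate j none := by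
  induction j with
  | zero => rfl
  | succ j ih => simp [List.replicate_succ, output, pad, ih]

theorem reduceOption_map_some (x : List B) : (x.map some).reduceOption = x := by
  simp [List.reduceOption, List.filterMap_map]

theorem reduceOption_output_pad (δ : S → B → S × List B) (s : S) (x : List (Option B)) :
    (output (pad δ) s x).reduceOption = output δ s x.reduceOption := by
  induction x generalizing s with
  | nil => rfl
  | cons a x ih =>
    rcases a with _ | a
    · simp [output, pad, ih]
    · simp [output, pad, ih, List.reduceOption_append, reduceOption_map_some]

/-- Deleting the padding letters of a fixed point of `pad δ` gives one of `δ`; conversely a fixed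
point of `δ` needs no padding. -/
theorem exists_output_pad_iff (δ : S → B → S × List B) (s : S) (w : List B) :
    (∃ x, w.map some ++ output (pad δ) s x = x) ↔ ∃ x, w ++ output δ s x = x := by
  constructor
  · rintro ⟨x, hx⟩
    refine ⟨x.reduceOption, ?_⟩
    have := congrArg List.reduceOption hx
    rwa [List.reduceOption_append, reduceOption_output_pad, reduceOption_map_some] at this
  · rintro ⟨x, hx⟩
    exact ⟨x.map some, by rw [output_pad_map, ← List.map_append, hx]⟩

/-- Padding letters reproduce themselves, so any number of them can follow a fixed point. -/
theorem infinite_setOf_output_pad {δ : S → B → S × List B} {s : S} {w : List (Option B)}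
    (h : ∃ x, w ++ output (pad δ) s x = x) : {x | w ++ output (pad δ) s x = x}.Infinite := by
  obtain ⟨x, hx⟩ := h
  refine Set.infinite_of_injective_forall_mem
    (f := fun j : ℕ => x ++ List.replicate j (none : Option B)) (fun i j hij => ?_) fun j => ?_
  · simpa using congrArg List.length hij
  · simp only [Set.mem_ofPred_eq]
    rw [output_append, output_pad_replicate, ← List.append_assoc, hx]

/-- Restriction of a queue machine to a set of states that is closed under transitions. -/
def restrict (δ : S → B → S × List B) (F : Set S) (hF : ∀ s ∈ F, ∀ a, (δ s a).1 ∈ F) :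
    F → B → F × List B :=
  fun s a => (⟨(δ s a).1, hF s s.2 a⟩, (δ s a).2)

theorem output_restrict (δ : S → B → S × List B) (F : Set S) (hF : ∀ s ∈ F, ∀ a, (δ s a).1 ∈ F)
    (s : F) (x : List B) : output (restrict δ F hF) s x = output δ s x := by
  induction x generalizing s with
  | nil => rfl
  | cons a x ih => simp [output, restrict, ih]

end QueueMachine

/-! ### Acceptance by automata that leave the pushdown store unchanged -/

namespace NIDDHPDA

variable {Q A Γ : Type*}

/-- The words that are accepted from the state `q` with empty pushdown store. -/
def acceptsFrom (M : NIDDHPDA Q A Γ) (q : Q) : Language A :=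
  {w | ∃ q' ∈ M.accept, ∃ s : List Γ, Relation.ReflTransGen M.Step (q, w, []) (q', [], s)}

/-- With neutral symbols only, the store stays empty, and acceptance unfolds by the first step
alone. -/
theorem mem_acceptsFrom_iff {M : NIDDHPDA Q A Γ} (hM : ∀ a, M.signature a = .neutral) {q : Q}
    {w : List A} :
    w ∈ M.acceptsFrom q ↔ (w = [] ∧ q ∈ M.accept) ∨
      (∃ a w' q', w = a :: w' ∧ q' ∈ M.neutralStep q .left ⟨a, hM a⟩ none ∧
        w' ∈ M.acceptsFrom q') ∨
      (∃ a w' q', w = w' ++ [a] ∧ q' ∈ M.neutralStep q .right ⟨a, hM a⟩ none ∧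
        w' ∈ M.acceptsFrom q') := by
  constructor
  · rintro ⟨f, hf, s, h⟩
    rcases Relation.ReflTransGen.cases_head h with h | ⟨c, h1, h2⟩
    · cases h
      exact .inl ⟨rfl, hf⟩
    · generalize hs : ([] : List Γ) = s₀ at h1
      generalize hd : (q, w, s₀) = d at h1
      cases h1 with
      | push_left ha => simp [hM] at ha
      | push_right ha => simp [hM] at ha
      | pop_left ha => simp [hM] at ha
      | pop_right ha => simp [hM] at ha
      | neutral_left ha h' =>
        cases hd
        subst hs
        exact .inr (.inl ⟨_, _, _, rfl, h', f, hf, s, h2⟩)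
      | neutral_right ha h' =>
        cases hd
        subst hs
        exact .inr (.inr ⟨_, _, _, rfl, h', f, hf, s, h2⟩)
  · rintro (⟨rfl, h⟩ | ⟨a, w', q', rfl, h, f, hf, s, hr⟩ | ⟨a, w', q', rfl, h, f, hf, s, hr⟩)
    · exact ⟨q, h, [], .refl⟩
    · exact ⟨f, hf, s, .head (.neutral_left (hM a) h) hr⟩
    · exact ⟨f, hf, s, .head (.neutral_right (hM a) h) hr⟩

end NIDDHPDA

/-! ### Checking the output of a queue machine with two heads -/

namespace TwoHead

variable {S B : Type*}

/-- The states of a deterministic device that checks whether a word has the form `x # y` where `y`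
reversed is the output of a queue machine on `x`. In `run s l`, the right head has yet to read the
letters `l` of that output. -/
inductive State (S B : Type*)
  | run (s : S) (l : List B)
  | bad
  | done

/-- The head that reads next. -/
def State.side : State S B → InputHead
  | .run _ (_ :: _) => .right
  | _ => .left

open Classical in
/-- The transition function of the device. The separator is `none`. -/
noncomputable def State.next (δ : S → B → S × List B) : State S B → Option B → State S B
  | .run s [], some a => .run (δ s a).1 (δ s a).2
  | .run _ [], none => .done
  | .run s (b :: l), a => if a = some b then .run s l else .bad
  | .bad, _ => .bad
  | .done, _ => .bad

/-- The words on which the device ends in the state `done`. -/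
def State.words (δ : S → B → S × List B) : State S B → Set (List (Option B))
  | .run s l =>
    {w | ∃ x : List B, w = x.map some ++ none :: (l ++ QueueMachine.output δ s x).reverse.map some}
  | .bad => ∅
  | .done => {[]}

theorem State.nil_mem_words {δ : S → B → S × List B} {p : State S B} :
    [] ∈ p.words δ ↔ p = .done := by
  cases p <;> simp [words]

theorem State.cons_mem_words {δ : S → B → S × List B} {p : State S B} (hp : p.side = .left)
    (a : Option B) (w : List (Option B)) : a :: w ∈ p.words δ ↔ w ∈ (p.next δ a).words δ := by
  rcases p with ⟨s, _ | ⟨b, l⟩⟩ | _ | _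
  · rcases a with _ | a
    · simp only [words, next]
      constructor
      · rintro ⟨_ | ⟨b, x⟩, h⟩
        · simpa [QueueMachine.output] using h
        · simp at h
      · rintro rfl
        exact ⟨[], by simp [QueueMachine.output]⟩
    · simp only [words, next]
      constructor
      · rintro ⟨_ | ⟨b, x⟩, h⟩
        · simp at h
        · simp only [List.map_cons, List.cons_append, List.cons.injEq, Option.some.injEq] at h
          obtain ⟨rfl, h⟩ := h
          exact ⟨x, by simpa [QueueMachine.output] using h⟩
      · rintro ⟨x, h⟩
        exact ⟨a :: x, by simpa [QueueMachine.output] using h⟩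
  · simp [side] at hp
  · simp [words, next]
  · simp [words, next]

/-- While a letter `b` is pending, every word still to be recognised ends in `b`, whatever `x` is.
-/
theorem State.append_mem_words {δ : S → B → S × List B} {p : State S B} (hp : p.side = .right)
    (a : Option B) (w : List (Option B)) : w ++ [a] ∈ p.words δ ↔ w ∈ (p.next δ a).words δ := by
  rcases p with ⟨s, _ | ⟨b, l⟩⟩ | _ | _
  · simp [side] at hp
  · have h : ∀ x : List B, (w ++ [a] = x.map some ++
        none :: ((b :: l) ++ QueueMachine.output δ s x).reverse.map some) ↔ a = some b ∧
        w = x.map some ++ none :: (l ++ QueueMachine.output δ s x).reverse.map some := by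
      intro x
      have : x.map some ++ none :: ((b :: l) ++ QueueMachine.output δ s x).reverse.map some =
          (x.map some ++ none :: (l ++ QueueMachine.output δ s x).reverse.map some) ++
            [some b] := by simp
      rw [this]
      constructor
      · intro h
        obtain ⟨h1, h2⟩ := List.append_inj' h rfl
        exact ⟨by simpa using h2, h1⟩
      · rintro ⟨rfl, h⟩
        rw [h]
    simp only [words, next]
    split_ifs with hab
    · exact exists_congr fun x => (h x).trans (and_iff_right hab)
    · exact iff_of_false (fun ⟨x, hx⟩ => hab ((h x).1 hx).1) id
  · simp [side] at hp
  · simp [side] at hp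

/-- If the states of an automaton without pushdown actions follow the transitions of the device,
and all states except for `done` accept, then the automaton accepts the complement. -/
theorem mem_acceptsFrom_iff {Q A Γ : Type*} {M : NIDDHPDA Q A Γ}
    (hM : ∀ a, M.signature a = .neutral) {δ : S → B → S × List B} (e : A → Option B)
    (R : Q → State S B → Prop)
    (hstep : ∀ {q p}, R q p → ∀ d a, ∀ q' ∈ M.neutralStep q d ⟨a, hM a⟩ none,
      d = p.side ∧ R q' (p.next δ (e a)))
    (htotal : ∀ {q p}, R q p → ∀ a, ∃ q', q' ∈ M.neutralStep q p.side ⟨a, hM a⟩ none)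
    (haccept : ∀ {q p}, R q p → (q ∈ M.accept ↔ p ≠ .done))
    {q : Q} {p : State S B} (h : R q p) (w : List A) :
    w ∈ M.acceptsFrom q ↔ w.map e ∉ p.words δ := by
  induction hn : w.length generalizing w q p with
  | zero =>
    obtain rfl := List.length_eq_zero_iff.1 hn
    rw [NIDDHPDA.mem_acceptsFrom_iff hM]
    simp [haccept h, State.nil_mem_words]
  | succ n ih =>
    have hne : w ≠ [] := by rintro rfl; simp at hn
    rw [NIDDHPDA.mem_acceptsFrom_iff hM]
    constructor
    · rintro (⟨hw, -⟩ | ⟨a, w', q', rfl, hq, hw⟩ | ⟨a, w', q', rfl, hq, hw⟩)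
      · exact absurd hw hne
      · obtain ⟨hd, hR⟩ := hstep h _ _ _ hq
        rw [List.map_cons, State.cons_mem_words hd.symm]
        exact (ih hR w' (by simpa using hn)).1 hw
      · obtain ⟨hd, hR⟩ := hstep h _ _ _ hq
        rw [List.map_append, List.map_singleton, State.append_mem_words hd.symm]
        exact (ih hR w' (by simpa using hn)).1 hw
    · intro hw
      rcases hd : p.side with _ | _
      · obtain ⟨a, w', rfl⟩ := List.exists_cons_of_ne_nil hne
        obtain ⟨q', hq⟩ := htotal h a
        rw [List.map_cons, State.cons_mem_words hd] at hw
        exact .inr (.inl ⟨a, w', q', rfl, hd ▸ hq,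
          (ih (hstep h _ _ _ hq).2 w' (by simpa using hn)).2 hw⟩)
      · obtain ⟨w', a, rfl⟩ := (List.eq_nil_or_concat' w).resolve_left hne
        obtain ⟨q', hq⟩ := htotal h a
        rw [List.map_append, List.map_singleton, State.append_mem_words hd] at hw
        exact .inr (.inr ⟨a, w', q', rfl, hd ▸ hq,
          (ih (hstep h _ _ _ hq).2 w' (by simpa using hn)).2 hw⟩)

/-- A nondeterministic choice between two devices, of which one starts with the left head and the
other one with the right head. -/
theorem mem_acceptsFrom_choice {Q A Γ : Type*} {M : NIDDHPDA Q A Γ}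
    (hM : ∀ a, M.signature a = .neutral) {δ : S → B → S × List B} (e : A → Option B)
    {p₁ p₂ : State S B} (hp₁ : p₁.side = .left) (hp₁' : p₁ ≠ .done) (hp₂ : p₂.side = .right)
    {q : Q} (hq : q ∈ M.accept) {t₁ t₂ : A → Q}
    (h₁ : ∀ a, M.neutralStep q .left ⟨a, hM a⟩ none = {t₁ a})
    (h₂ : ∀ a, M.neutralStep q .right ⟨a, hM a⟩ none = {t₂ a})
    (ht₁ : ∀ a w, w ∈ M.acceptsFrom (t₁ a) ↔ w.map e ∉ (p₁.next δ (e a)).words δ)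
    (ht₂ : ∀ a w, w ∈ M.acceptsFrom (t₂ a) ↔ w.map e ∉ (p₂.next δ (e a)).words δ) (w : List A) :
    w ∈ M.acceptsFrom q ↔ ¬ (w.map e ∈ p₁.words δ ∧ w.map e ∈ p₂.words δ) := by
  rw [NIDDHPDA.mem_acceptsFrom_iff hM]
  simp only [h₁, h₂, Set.mem_singleton_iff]
  constructor
  · rintro (⟨rfl, -⟩ | ⟨a, w', q', rfl, rfl, hw⟩ | ⟨a, w', q', rfl, rfl, hw⟩)
    -- The empty word is accepted at once, which is correct because `p₁` is not `done`.
    · simp [State.nil_mem_words, hp₁']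
    · rw [List.map_cons, State.cons_mem_words hp₁]
      exact fun h => (ht₁ a w').1 hw h.1
    · rw [List.map_append, List.map_singleton, State.append_mem_words hp₂]
      exact fun h => (ht₂ a w').1 hw h.2
  · intro h
    by_cases hne : w = []
    · exact .inl ⟨hne, hq⟩
    · refine .inr ?_
      rcases not_and_or.1 h with h | h
      · obtain ⟨a, w', rfl⟩ := List.exists_cons_of_ne_nil hne
        rw [List.map_cons, State.cons_mem_words hp₁] at h
        exact .inl ⟨a, w', _, rfl, rfl, (ht₁ a w').2 h⟩
      · obtain ⟨w', a, rfl⟩ := (List.eq_nil_or_concat' w).resolve_left hne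
        rw [List.map_append, List.map_singleton, State.append_mem_words hp₂] at h
        exact .inr ⟨a, w', _, rfl, rfl, (ht₂ a w').2 h⟩

/-! ### Encodings `x # xᴿ` of fixed points -/

/-- The queue machine with an additional state `none` in which it copies its queue. -/
def withCopy (δ : S → B → S × List B) : Option S → B → Option S × List B
  | none, a => (none, [a])
  | some s, a => (some (δ s a).1, (δ s a).2)

theorem output_withCopy_none (δ : S → B → S × List B) (x : List B) :
    QueueMachine.output (withCopy δ) none x = x := by
  induction x with
  | nil => rfl
  | cons a x ih => simp [QueueMachine.output, withCopy, ih]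

theorem output_withCopy_some (δ : S → B → S × List B) (s : S) (x : List B) :
    QueueMachine.output (withCopy δ) (some s) x = QueueMachine.output δ s x := by
  induction x generalizing s with
  | nil => rfl
  | cons a x ih => simp [QueueMachine.output, withCopy, ih]

theorem map_some_append_none_inj {x y x' y' : List B}
    (h : x.map some ++ none :: y.map some = x'.map some ++ none :: y'.map some) :
    x = x' ∧ y = y' := by
  induction x generalizing x' with
  | nil =>
    rcases x' with _ | ⟨b, x'⟩
    · simpa [List.map_inj_right (Option.some_injective B)] using h
    · simp at h
  | cons a x ih =>
    rcases x' with _ | ⟨b, x'⟩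
    · simp at h
    · simp only [List.map_cons, List.cons_append, List.cons.injEq, Option.some.injEq] at h
      obtain ⟨rfl, h⟩ := h
      obtain ⟨rfl, rfl⟩ := ih h
      exact ⟨rfl, rfl⟩

/-- The separator occurs only once, so both devices see the same `x`, and the parts behind it force
`x` to equal `l ++ output x`. -/
theorem mem_words_copy_and {δ : S → B → S × List B} {s : S} {l : List B} {w : List (Option B)} :
    (w ∈ (State.run none []).words (withCopy δ) ∧ w ∈ (State.run (some s) l).words (withCopy δ)) ↔
      ∃ x, l ++ QueueMachine.output δ s x = x ∧ w = x.map some ++ none :: x.reverse.map some := by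
  simp only [State.words, output_withCopy_none, output_withCopy_some, Set.mem_ofPred_eq,
    List.nil_append]
  constructor
  · rintro ⟨⟨x, rfl⟩, y, h⟩
    obtain ⟨rfl, h⟩ := map_some_append_none_inj h
    exact ⟨x, (List.reverse_injective h).symm, rfl⟩
  · rintro ⟨x, h, rfl⟩
    exact ⟨⟨x, rfl⟩, x, by rw [h]⟩

/-- A language whose complement consists of the words `x # xᴿ` for infinitely many `x` is not
regular. -/
theorem not_isRegular {A : Type*} (e : A ≃ Option B) {X : Set (List B)} (hX : X.Infinite)
    {L : Language A}
    (hL : ∀ w, w ∈ L ↔ ¬ ∃ x ∈ X, w.map e = x.map some ++ none :: x.reverse.map some) :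
    ¬ L.IsRegular := by
  intro h
  obtain ⟨σ, _, M, hM⟩ := h.compl
  have he : ∀ w : List (Option B), (w.map e.symm).map e = w := fun w => by simp
  have hmem : ∀ w, M.eval w ∈ M.accept ↔
      ∃ x ∈ X, w.map e = x.map some ++ none :: x.reverse.map some := by
    intro w
    rw [← DFA.mem_accepts, hM, ← not_iff_not, ← hL]
    exact not_not
  -- Pigeonhole: two members of `X` lead to the same state after the separator, so `x # yᴿ` is
  -- treated like `y # yᴿ`.
  obtain ⟨x, hx, y, hy, hne, hxy⟩ := hX.exists_ne_map_eq_of_mapsTo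
    (f := fun x => M.eval ((x.map some ++ [none]).map e.symm)) (t := Set.univ)
    (fun _ _ => trivial) Set.finite_univ
  have h1 : M.eval ((y.map some ++ none :: y.reverse.map some).map e.symm) ∈ M.accept :=
    (hmem _).2 ⟨y, hy, he _⟩
  have h2 : M.eval ((x.map some ++ none :: y.reverse.map some).map e.symm) ∈ M.accept := by
    have key : ∀ z : List B, M.eval ((z.map some ++ none :: y.reverse.map some).map e.symm) =
        M.evalFrom (M.eval ((z.map some ++ [none]).map e.symm))
          ((y.reverse.map some).map e.symm) := by
      intro z
      rw [DFA.eval, ← DFA.evalFrom_of_append]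
      simp
    rw [key] at h1 ⊢
    exact hxy ▸ h1
  obtain ⟨z, -, hz⟩ := (hmem _).1 h2
  rw [he] at hz
  obtain ⟨rfl, h3⟩ := map_some_append_none_inj hz
  exact hne (List.reverse_injective h3).symm

end TwoHead

/-! ### Simulation of a machine with four stacks by a queue machine -/

namespace StackQueue

open StateTransition Turing Turing.PartrecToTM2

/-- The cyclic order of the four stacks. -/
def next : K' → K'
  | .main => .rev
  | .rev => .aux
  | .aux => .stack
  | .stack => .main

/-- The queue that lists the stacks in cyclic order from `k`, each one followed by `none`. -/
def enc (T : K' → List Γ') (k : K') : List (Option Γ') :=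
  [k, next k, next (next k), next (next (next k))].flatMap fun i => (T i).map some ++ [none]

/-- The part of the queue behind the first stack. -/
def encTail (T : K' → List Γ') (k : K') : List (Option Γ') :=
  [next k, next (next k), next (next (next k))].flatMap fun i => (T i).map some ++ [none]

theorem enc_eq (T : K' → List Γ') (k : K') :
    enc T k = (T k).map some ++ none :: encTail T k := by
  simp [enc, encTail]

/-- `next` is a cycle of length four, so the stack just processed comes last in the order from `next
k`. -/
theorem enc_update_next (T : K' → List Γ') (k : K') (l : List Γ') :
    enc (Function.update T k l) (next k) = encTail T k ++ l.map some ++ [none] := by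
  cases k <;> simp [enc, encTail, next, Function.update]

/-- The states of the queue machine: `ready q v k` is about to read the stack `k` in order to
execute `q`, `copy q v k` copies the rest of that stack, and `drain` empties the queue. -/
inductive State
  | ready (q : Stmt') (v : Option Γ') (k : K')
  | copy (q : Stmt') (v : Option Γ') (k : K')
  | drain

/-- The effect of a statement when the stack `k` with topmost symbol `a` is read: the new statement,
the new variable setting, and the symbols that replace the topmost symbol. There is none for `halt`.
-/
def act : Stmt' → Option Γ' → K' → Option Γ' → Option (Stmt' × Option Γ' × List Γ')
  | .push i f q, v, k, a =>
    some (if k = i then (q, v, f v :: a.toList) else (.push i f q, v, a.toList))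
  | .peek i f q, v, k, a =>
    some (if k = i then (q, f v a, a.toList) else (.peek i f q, v, a.toList))
  | .pop i f q, v, k, a => some (if k = i then (q, f v a, []) else (.pop i f q, v, a.toList))
  | .load f q, v, _, a => some (q, f v, a.toList)
  | .branch f q₁ q₂, v, _, a => some (cond (f v) q₁ q₂, v, a.toList)
  | .goto f, v, _, a => some (tr (f v), v, a.toList)
  | .halt, _, _, _ => none

/-- The transition function of the queue machine. -/
def delta : State → Option Γ' → State × List (Option Γ')
  | .ready q v k, some a =>
    match act q v k (some a) with
    | some (q', v', l) => (.copy q' v' k, l.map some)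
    | none => (.drain, [])
  | .ready q v k, none =>
    match act q v k none with
    | some (q', v', l) => (.ready q' v' (next k), l.map some ++ [none])
    | none => (.drain, [])
  | .copy q v k, some a => (.copy q v k, [some a])
  | .copy q v k, none => (.ready q v (next k), [none])
  | .drain, _ => (.drain, [])

theorem reaches_copy (q : Stmt') (v : Option Γ') (k : K') (l : List Γ') (w : List (Option Γ')) :
    Reaches (QueueMachine.step delta) (.copy q v k, l.map some ++ none :: w)
      (.ready q v (next k), w ++ l.map some ++ [none]) := by
  induction l generalizing w with
  | nil => exact .single (by simp [QueueMachine.step, delta])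
  | cons a l ih =>
    have := ih (w ++ [some a])
    refine .head (b := (.copy q v k, l.map some ++ none :: (w ++ [some a]))) ?_ ?_
    · simp [QueueMachine.step, delta]
    · simpa [Reaches] using this

theorem reaches_drain (w : List (Option Γ')) :
    Reaches (QueueMachine.step delta) (.drain, w) (.drain, []) := by
  induction w with
  | nil => exact .refl
  | cons a w ih =>
    have h : (State.drain, w) ∈ QueueMachine.step delta (.drain, a :: w) := by
      simp [QueueMachine.step, delta]
    exact .head h ih

/-- One turn: the top is replaced by `l` and the rest of the stack is copied to the rear. For an
empty stack the end marker itself is read in place of a top, and a single step suffices. -/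
theorem reaches₁_of_act {q q' : Stmt'} {v v' : Option Γ'} {k : K'} {T : K' → List Γ'} {l : List Γ'}
    (h : act q v k (T k).head? = some (q', v', l)) :
    Reaches₁ (QueueMachine.step delta) (.ready q v k, enc T k)
      (.ready q' v' (next k), enc (Function.update T k (l ++ (T k).tail)) (next k)) := by
  rw [enc_eq, enc_update_next]
  rcases hT : T k with _ | ⟨a, t⟩
  · rw [hT] at h
    refine .single ?_
    simp only [List.head?_nil] at h
    simp [QueueMachine.step, delta, h]
  · rw [hT] at h
    simp only [List.head?_cons] at h
    refine .head' (b := (.copy q' v' k, t.map some ++ none :: (encTail T k ++ l.map some))) ?_ ?_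
    · simp [QueueMachine.step, delta, h]
    · simpa [Reaches] using reaches_copy q' v' k t (encTail T k ++ l.map some)

theorem reaches₁_of_act_toList {q q' : Stmt'} {v v' : Option Γ'} {k : K'} {T : K' → List Γ'}
    (h : act q v k (T k).head? = some (q', v', (T k).head?.toList)) :
    Reaches₁ (QueueMachine.step delta) (.ready q v k, enc T k)
      (.ready q' v' (next k), enc T (next k)) := by
  have h2 : (T k).head?.toList ++ (T k).tail = T k := by cases T k <;> rfl
  simpa [h2] using reaches₁_of_act h

/-- A statement that ignores all stacks but `i` waits for the stack `i`. -/
theorem reaches_ready {q : Stmt'} {v : Option Γ'} {i : K'} {T : K' → List Γ'}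
    (h : ∀ k a, k ≠ i → act q v k a = some (q, v, a.toList)) (k : K') :
    Reaches (QueueMachine.step delta) (.ready q v k, enc T k) (.ready q v i, enc T i) := by
  have h1 : ∀ k, k ≠ i → Reaches (QueueMachine.step delta) (.ready q v k, enc T k)
      (.ready q v (next k), enc T (next k)) :=
    fun k hk => (reaches₁_of_act_toList (h k _ hk)).to_reflTransGen
  have h2 : ∀ k, next k = i → Reaches (QueueMachine.step delta) (.ready q v k, enc T k)
      (.ready q v i, enc T i) := fun k hk => by
    by_cases hki : k = i
    · subst hki; exact .refl
    · simpa [hk] using h1 k hki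
  have h3 : ∀ k, next (next k) = i → Reaches (QueueMachine.step delta) (.ready q v k, enc T k)
      (.ready q v i, enc T i) := fun k hk => by
    by_cases hki : k = i
    · subst hki; exact .refl
    · exact (h1 k hki).trans (h2 _ hk)
  have h4 : ∀ k, next (next (next k)) = i → Reaches (QueueMachine.step delta)
      (.ready q v k, enc T k) (.ready q v i, enc T i) := fun k hk => by
    by_cases hki : k = i
    · subst hki; exact .refl
    · exact (h1 k hki).trans (h3 _ hk)
  have h5 : k = i ∨ next k = i ∨ next (next k) = i ∨ next (next (next k)) = i := by
    cases k <;> cases i <;> simp [next]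
  rcases h5 with rfl | h5 | h5 | h5
  exacts [.refl, h2 k h5, h3 k h5, h4 k h5]

/-- The relation between configurations of the stack machine and of the queue machine. -/
def Rel (c : Cfg') (x : State × List (Option Γ')) : Prop :=
  match c.l with
  | some l => ∃ k, x = (.ready (tr l) c.var k, enc c.stk k)
  | none => x = (.drain, [])

/-- Each statement rotates the queue until the stack it needs is in front and then uses one more
turn. The stack reached at the end is not controlled, so `Rel` allows any `k`. -/
theorem exists_rel_stepAux (q : Stmt') (v : Option Γ') (T : K' → List Γ') (k : K') :
    ∃ x, Rel (TM2.stepAux q v T) x ∧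
      Reaches₁ (QueueMachine.step delta) (.ready q v k, enc T k) x := by
  have key : ∀ {q q' : Stmt'} {v v' : Option Γ'} {T T' : K' → List Γ'} {k k' : K'} {c : Cfg'},
      Reaches₁ (QueueMachine.step delta) (.ready q v k, enc T k) (.ready q' v' k', enc T' k') →
      (∃ x, Rel c x ∧ Reaches₁ (QueueMachine.step delta) (.ready q' v' k', enc T' k') x) →
      ∃ x, Rel c x ∧ Reaches₁ (QueueMachine.step delta) (.ready q v k, enc T k) x :=
    fun h ⟨x, hx, hr⟩ => ⟨x, hx, h.trans hr⟩
  induction q generalizing v T k with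
  | push i f q ih =>
    refine key (.trans_right (reaches_ready (i := i) (fun k a hk => by simp [act, hk]) k)
      (reaches₁_of_act (q' := q) (v' := v) (l := f v :: (T i).head?.toList) (by simp [act]))) ?_
    have : f v :: (T i).head?.toList ++ (T i).tail = f v :: T i := by cases T i <;> rfl
    rw [this]
    exact ih _ _ _
  | peek i f q ih =>
    exact key (.trans_right (reaches_ready (i := i) (fun k a hk => by simp [act, hk]) k)
      (reaches₁_of_act_toList (q' := q) (v' := f v (T i).head?) (by simp [act]))) (ih _ _ _)
  | pop i f q ih =>
    exact key (.trans_right (reaches_ready (i := i) (fun k a hk => by simp [act, hk]) k)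
      (reaches₁_of_act (q' := q) (v' := f v (T i).head?) (l := []) (by simp [act]))) (ih _ _ _)
  | load f q ih =>
    exact key (reaches₁_of_act_toList (q' := q) (v' := f v) (by simp [act])) (ih _ _ _)
  | branch f q₁ q₂ ih₁ ih₂ =>
    refine key (reaches₁_of_act_toList (q' := cond (f v) q₁ q₂) (v' := v) (by simp [act])) ?_
    rw [TM2.stepAux]
    cases f v
    · exact ih₂ _ _ _
    · exact ih₁ _ _ _
  | goto f =>
    exact ⟨_, ⟨_, rfl⟩, reaches₁_of_act_toList (q' := tr (f v)) (v' := v) (by simp [act])⟩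
  | halt =>
    refine ⟨_, rfl, ?_⟩
    rw [enc_eq]
    rcases T k with _ | ⟨a, t⟩
    · have h : (State.drain, encTail T k) ∈ QueueMachine.step delta
          (.ready .halt v k, ([] : List Γ').map some ++ none :: encTail T k) := by
        simp [QueueMachine.step, delta, act]
      exact .head' h (reaches_drain _)
    · have h : (State.drain, t.map some ++ none :: encTail T k) ∈ QueueMachine.step delta
          (.ready .halt v k, (a :: t).map some ++ none :: encTail T k) := by
        simp [QueueMachine.step, delta, act]
      exact .head' h (reaches_drain _)

theorem respects : Respects (TM2.step tr) (QueueMachine.step delta) Rel := by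
  rintro ⟨_ | l, v, T⟩ x h
  · simp only [Rel] at h
    subst h
    rfl
  · obtain ⟨k, rfl⟩ := h
    exact exists_rel_stepAux _ _ _ _

/-! ### Finiteness of the state set -/

/-- The states of the queue machine whose statements occur in the statements of labels in `L`. -/
def states (L : Finset Λ') : Set State :=
  {s | ∀ q v k, s = .ready q v k ∨ s = .copy q v k → some q ∈ TM2.stmts tr L}

theorem finite_states (L : Finset Λ') : (states L).Finite := by
  have : Finite K' := Finite.of_injective (β := Fin 4)
    (fun | .main => 0 | .rev => 1 | .aux => 2 | .stack => 3) (by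
      intro a b; cases a <;> cases b <;> simp)
  have hF : {q : Stmt' | some q ∈ TM2.stmts tr L}.Finite :=
    Set.Finite.preimage (Option.some_injective _).injOn (TM2.stmts tr L).finite_toSet
  have hP := (hF.prod (Set.finite_univ (α := Option Γ' × K')))
  refine ((hP.image fun p => State.ready p.1 p.2.1 p.2.2).union
    ((hP.image fun p => State.copy p.1 p.2.1 p.2.2).union (Set.finite_singleton .drain))).subset ?_
  rintro (⟨q, v, k⟩ | ⟨q, v, k⟩ | _) hs
  · exact .inl ⟨(q, v, k), ⟨hs q v k (.inl rfl), trivial⟩, rfl⟩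
  · exact .inr (.inl ⟨(q, v, k), ⟨hs q v k (.inr rfl), trivial⟩, rfl⟩)
  · exact .inr (.inr rfl)

theorem some_mem_stmts {K Λ σ : Type*} {Γ : K → Type*} {M : Λ → TM2.Stmt Γ Λ σ} {L : Finset Λ}
    {q : TM2.Stmt Γ Λ σ} : some q ∈ TM2.stmts M L ↔ ∃ l ∈ L, q ∈ TM2.stmts₁ (M l) := by
  simp [TM2.stmts]

/-- The new statement is `q`, a substatement of it, or the target of a `goto`, whose label stays in
`L` by `hL`. -/
theorem act_mem {L : Finset Λ'} (hL : ∀ l ∈ L, TM2.SupportsStmt L (tr l)) {q q' : Stmt'}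
    {v v' : Option Γ'} {k : K'} {a : Option Γ'} {l : List Γ'} (hq : some q ∈ TM2.stmts tr L)
    (h : act q v k a = some (q', v', l)) : some q' ∈ TM2.stmts tr L := by
  classical
  have hsub : ∀ {q' : Stmt'}, q' ∈ TM2.stmts₁ q → some q' ∈ TM2.stmts tr L :=
    fun h => TM2.stmts_trans h hq
  have hsup : TM2.SupportsStmt L q := by
    obtain ⟨l, hl, h⟩ := some_mem_stmts.1 hq
    exact TM2.stmts₁_supportsStmt_mono h (hL l hl)
  cases q with
  | push i f q =>
    simp only [act, Option.some.injEq] at h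
    split_ifs at h <;> cases h
    · exact hsub (Finset.mem_insert_of_mem TM2.stmts₁_self)
    · exact hq
  | peek i f q =>
    simp only [act, Option.some.injEq] at h
    split_ifs at h <;> cases h
    · exact hsub (Finset.mem_insert_of_mem TM2.stmts₁_self)
    · exact hq
  | pop i f q =>
    simp only [act, Option.some.injEq] at h
    split_ifs at h <;> cases h
    · exact hsub (Finset.mem_insert_of_mem TM2.stmts₁_self)
    · exact hq
  | load f q =>
    simp only [act, Option.some.injEq] at h
    cases h
    exact hsub (Finset.mem_insert_of_mem TM2.stmts₁_self)
  | branch f q₁ q₂ =>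
    simp only [act, Option.some.injEq] at h
    cases h
    cases f v
    · exact hsub (Finset.mem_insert_of_mem (Finset.mem_union_right _ TM2.stmts₁_self))
    · exact hsub (Finset.mem_insert_of_mem (Finset.mem_union_left _ TM2.stmts₁_self))
  | goto f =>
    simp only [act, Option.some.injEq] at h
    cases h
    exact some_mem_stmts.2 ⟨_, hsup v, TM2.stmts₁_self⟩
  | halt => simp [act] at h

theorem delta_mem {L : Finset Λ'} (hL : ∀ l ∈ L, TM2.SupportsStmt L (tr l)) {s : State}
    (hs : s ∈ states L) (a : Option Γ') : (delta s a).1 ∈ states L := by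
  have hr : ∀ {q v k}, some q ∈ TM2.stmts tr L → State.ready q v k ∈ states L := by
    rintro q v k h _ _ _ (h' | h') <;> cases h'
    exact h
  have hc : ∀ {q v k}, some q ∈ TM2.stmts tr L → State.copy q v k ∈ states L := by
    rintro q v k h _ _ _ (h' | h') <;> cases h'
    exact h
  have hd : State.drain ∈ states L := by
    rintro _ _ _ (h' | h') <;> cases h'
  rcases s with ⟨q, v, k⟩ | ⟨q, v, k⟩ | _
  · have hq := hs q v k (.inl rfl)
    rcases a with _ | a
    · rcases h : act q v k none with _ | ⟨q', v', l⟩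
      · simpa [delta, h] using hd
      · simpa [delta, h] using hr (act_mem hL hq h)
    · rcases h : act q v k (some a) with _ | ⟨q', v', l⟩
      · simpa [delta, h] using hd
      · simpa [delta, h] using hc (act_mem hL hq h)
  · have hq := hs q v k (.inr rfl)
    rcases a with _ | a
    · exact hr hq
    · exact hc hq
  · exact hd

theorem trPosNum_of_pow (j : ℕ) : ∃ p : PosNum, (p : ℕ) = 2 ^ j ∧
    trPosNum p = List.replicate j Γ'.bit0 ++ [Γ'.bit1] := by
  induction j with
  | zero => exact ⟨1, rfl, rfl⟩
  | succ j ih =>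
    obtain ⟨p, hp, h⟩ := ih
    refine ⟨.bit0 p, ?_, ?_⟩
    · rw [PosNum.cast_bit0, hp]; ring
    · rw [trPosNum, h]; rfl

/-- Numbers are stored with the lowest bit first. Powers of two thus give one repeated letter and a
fixed suffix, a form that a countdown can check. -/
theorem trList_two_pow (j : ℕ) :
    trList [2 ^ j] = List.replicate j Γ'.bit0 ++ [Γ'.bit1, Γ'.cons] := by
  obtain ⟨p, hp, h⟩ := trPosNum_of_pow j
  have : trNat (2 ^ j) = trPosNum p := by
    rw [trNat, ← hp]
    have : (((p : ℕ) : Num)) = Num.pos p := by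
      rw [← PosNum.cast_to_num, PosNum.cast_to_nat]
    rw [this]; rfl
  simp [trList, this, h]

/-- Halting of a partial recursive function on powers of two, as halting of a finite queue machine.
-/
theorem exists_queueMachine {f : ℕ →. ℕ} (hf : Partrec f) :
    ∃ (S : Type) (_ : Finite S) (δ : S → Option Γ' → S × List (Option Γ')) (s₀ : S),
      ∀ j, (f (2 ^ j)).Dom ↔ ∃ x, List.replicate j (some Γ'.bit0) ++
        [some Γ'.bit1, some Γ'.cons, none, none, none, none] ++ QueueMachine.output δ s₀ x = x := by
  obtain ⟨c, hc⟩ := ToPartrec.Code.exists_code (Nat.Partrec'.part_iff₁.2 hf)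
  have hsup := tr_supports c .halt
  set L := codeSupp c .halt
  have hmem : State.ready (tr (trNormal c .halt)) none .main ∈ states L := by
    rintro _ _ _ (h | h) <;> cases h
    exact some_mem_stmts.2 ⟨_, hsup.1, TM2.stmts₁_self⟩
  refine ⟨states L, (finite_states L).to_subtype,
    QueueMachine.restrict delta (states L) (fun s hs a => delta_mem hsup.2 hs a),
    ⟨_, hmem⟩, fun j => ?_⟩
  simp only [QueueMachine.output_restrict]
  rw [← QueueMachine.eval_dom_iff]
  have hrel : Rel (init c [2 ^ j]) (.ready (tr (trNormal c .halt)) none .main,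
      List.replicate j (some Γ'.bit0) ++ [some Γ'.bit1, some Γ'.cons, none, none, none, none]) := by
    refine ⟨.main, ?_⟩
    have : init c [2 ^ j] = ⟨some (trNormal c .halt), none, K'.elim (trList [2 ^ j]) [] [] []⟩ := rfl
    rw [this, trList_two_pow]
    simp [enc, next]
  rw [tr_eval_dom respects hrel, PartrecToTM2.tr_eval, hc ⟨[2 ^ j], rfl⟩]
  simp [List.Vector.head]

end StackQueue

namespace TwoHead

/-! ### Descriptions of the automata -/

section Code

variable {k : ℕ}

/-- The transitions of the states `0, …, N`: in state `j` the head `side j` reads. -/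
def fixedTable (N : ℕ) (side : ℕ → InputHead) (target : ℕ → Fin k → ℕ) :
    List (ℕ × InputHead × ℕ × Option ℕ × ℕ) :=
  (List.range (N + 1)).flatMap fun j => (List.finRange k).map fun a =>
    (j, side j, a.val, none, target j a)

/-- The transitions of the states `N + 1, …, N + m + 1`: the right head reads the letter `c`, and
the state decreases by one. Every other letter leads to the state `bad`. -/
def chainTable (N : ℕ) (c : Fin k) (bad : ℕ) (m : ℕ) :
    List (ℕ × InputHead × ℕ × Option ℕ × ℕ) :=
  (List.range (m + 1)).flatMap fun i => (List.finRange k).map fun a =>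
    (N + i + 1, InputHead.right, a.val, none, if a = c then N + i else bad)

/-- The transitions of the initial state `N + m + 1` with the left head. -/
def startTable (N : ℕ) (target : Fin k → ℕ) (m : ℕ) : List (ℕ × InputHead × ℕ × Option ℕ × ℕ) :=
  (List.finRange k).map fun a => (N + m + 1, InputHead.left, a.val, none, target a)

/-- The automaton with these transitions. -/
def code (N : ℕ) (side : ℕ → InputHead) (target : ℕ → Fin k → ℕ) (c : Fin k) (bad : ℕ)
    (startTarget : Fin k → ℕ) (accept : List ℕ) (m : ℕ) : NIDDHPDACode where
  lastState := N + m + 1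
  numSymbols := k
  numStack := 0
  signature := []
  init := N + m + 1
  accept := accept ++ (List.range (m + 1)).map fun i => N + i + 1
  pushes := []
  pops := []
  neutrals := fixedTable N side target ++ chainTable N c bad m ++ startTable N startTarget m

/-- `side` and `target` may be arbitrary: `fixedTable` does not depend on `m`, and `startTarget` has
a finite domain. -/
theorem primrec_code (N : ℕ) (side : ℕ → InputHead) (target : ℕ → Fin k → ℕ) (c : Fin k)
    (bad : ℕ) (startTarget : Fin k → ℕ) (accept : List ℕ) :
    Primrec (code N side target c bad startTarget accept) := by
  have hadd : Primrec fun i : ℕ => N + i + 1 :=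
    Primrec.succ.comp (Primrec.nat_add.comp (.const N) .id)
  have hrange : Primrec fun m : ℕ => List.range (m + 1) := Primrec.list_range.comp .succ
  have hacc : Primrec fun m : ℕ => accept ++ (List.range (m + 1)).map fun i => N + i + 1 :=
    Primrec.list_append.comp (.const _) (Primrec.list_map hrange (hadd.comp .snd).to₂)
  have hval : Primrec fun a : Fin k => a.val := Primrec.fin_val
  have hstart : Primrec (startTable N startTarget) := by
    refine Primrec.list_map (.const _) ?_
    exact Primrec.pair (hadd.comp .fst) (Primrec.pair (.const _) (Primrec.pair (hval.comp .snd)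
      (Primrec.pair (.const _) ((Primrec.dom_finite startTarget).comp .snd))))
  have hchain : Primrec (chainTable N c bad) := by
    refine Primrec.list_flatMap hrange ?_
    refine Primrec.list_map (.const _) ?_
    have h1 : Primrec fun p : (ℕ × ℕ) × Fin k => p.1.2 := Primrec.snd.comp .fst
    have h2 : Primrec fun p : (ℕ × ℕ) × Fin k => if p.2 = c then N + p.1.2 else bad :=
      Primrec.ite (Primrec.eq.comp .snd (.const c)) (Primrec.nat_add.comp (.const N) h1) (.const _)
    exact Primrec.pair (hadd.comp h1) (Primrec.pair (.const _) (Primrec.pair (hval.comp .snd)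
      (Primrec.pair (.const _) h2)))
  have htuple : Primrec fun m : ℕ => NIDDHPDACode.equivTuple
      (code N side target c bad startTarget accept m) :=
    Primrec.pair hadd <| Primrec.pair (.const _) <| Primrec.pair (.const _) <|
      Primrec.pair (.const _) <| Primrec.pair hadd <| Primrec.pair hacc <|
      Primrec.pair (.const _) <| Primrec.pair (.const _) <|
      Primrec.list_append.comp (Primrec.list_append.comp (.const _) hchain) hstart
  exact (Primrec.of_equiv_iff NIDDHPDACode.equivTuple).1 htuple

theorem mem_neutralStep_code {N : ℕ} {side : ℕ → InputHead} {target : ℕ → Fin k → ℕ} {c : Fin k}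
    {bad : ℕ} {startTarget : Fin k → ℕ} {accept : List ℕ} {m : ℕ} {q q' : Fin (N + m + 1 + 1)}
    {d : InputHead} {a : Fin k} {ha} :
    q' ∈ (code N side target c bad startTarget accept m).toNIDDHPDA.neutralStep q d ⟨a, ha⟩ none ↔
      (q.val ≤ N ∧ d = side q ∧ q'.val = target q a) ∨
      (∃ i ≤ m, q.val = N + i + 1 ∧ d = .right ∧ q'.val = if a = c then N + i else bad) ∨
      (q.val = N + m + 1 ∧ d = .left ∧ q'.val = startTarget a) := by
  change (q.val, d, a.val, none, q'.val) ∈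
    fixedTable N side target ++ chainTable N c bad m ++ startTable N startTarget m ↔ _
  rw [List.mem_append, List.mem_append, or_assoc]
  refine or_congr ?_ (or_congr ?_ ?_)
  · simp only [fixedTable, List.mem_flatMap, List.mem_range, List.mem_map, List.mem_finRange,
      true_and, Prod.mk.injEq, Fin.val_inj]
    constructor
    · rintro ⟨j, hj, b, rfl, rfl, rfl, h⟩
      exact ⟨by omega, rfl, h.symm⟩
    · rintro ⟨h1, rfl, h2⟩
      exact ⟨q, by omega, a, rfl, rfl, rfl, h2.symm⟩
  · simp only [chainTable, List.mem_flatMap, List.mem_range, List.mem_map, List.mem_finRange,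
      true_and, Prod.mk.injEq, Fin.val_inj]
    constructor
    · rintro ⟨i, hi, b, h1, rfl, rfl, h⟩
      exact ⟨i, by omega, h1.symm, rfl, h.symm⟩
    · rintro ⟨i, hi, h1, rfl, h2⟩
      exact ⟨i, by omega, a, h1.symm, rfl, rfl, h2.symm⟩
  · simp only [startTable, List.mem_map, List.mem_finRange, true_and, Prod.mk.injEq, Fin.val_inj]
    constructor
    · rintro ⟨b, h1, rfl, rfl, h⟩
      exact ⟨h1.symm, rfl, h.symm⟩
    · rintro ⟨h1, rfl, h2⟩
      exact ⟨a, h1.symm, rfl, rfl, h2.symm⟩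

end Code

variable {S B : Type*}

/-- A finite set of states of the device that is closed under transitions. -/
theorem exists_finite_closed [Finite S] [Finite B] (δ : S → B → S × List B) (l : List B) :
    ∃ F : Set (State S B), F.Finite ∧ (∀ s, .run s l ∈ F) ∧ .bad ∈ F ∧ .done ∈ F ∧
      (∀ s a, .run (δ s a).1 (δ s a).2 ∈ F) ∧ ∀ p ∈ F, ∀ a, p.next δ a ∈ F := by
  -- A pending list only shrinks until it is empty and replaced by a word that `δ` appends, so
  -- lengths stay below `max K l.length`.
  obtain ⟨K, hK⟩ := (Set.finite_range fun p : S × B => (δ p.1 p.2).2.length).bddAbove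
  have hK : ∀ s a, (δ s a).2.length ≤ K := fun s a => hK ⟨(s, a), rfl⟩
  have hfin : {l' : List B | l'.length ≤ max K l.length}.Finite := List.finite_length_le _ _
  refine ⟨(fun p : S × List B => State.run p.1 p.2) ''
      (Set.univ ×ˢ {l' : List B | l'.length ≤ max K l.length}) ∪ {.bad, .done},
    ((Set.finite_univ.prod hfin).image _).union (by simp), ?_, by simp, by simp, ?_, ?_⟩
  · exact fun s => .inl ⟨(s, l), by simp, rfl⟩
  · exact fun s a => .inl ⟨δ s a, by simp [hK s a], rfl⟩
  · rintro p (⟨⟨s, l'⟩, ⟨-, hl⟩, rfl⟩ | rfl | rfl) a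
    · rcases l' with _ | ⟨b, l'⟩
      · rcases a with _ | a
        · exact .inr (.inr rfl)
        · exact .inl ⟨δ s a, by simp [hK s a], rfl⟩
      · simp only [State.next]
        split_ifs
        · refine .inl ⟨(s, l'), ⟨trivial, ?_⟩, rfl⟩
          have : (b :: l').length ≤ max K l.length := hl
          simp only [List.length_cons] at this
          exact (Nat.le_succ _).trans this
        · exact .inr (.inl rfl)
    · exact .inr (.inl rfl)
    · exact .inr (.inl rfl)

theorem exists_numbering {α : Type*} {F : Set α} (hF : F.Finite) (x : α) :
    ∃ (N : ℕ) (num : α → ℕ) (dec : ℕ → α),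
      (∀ p ∈ F, num p < N ∧ dec (num p) = p) ∧ (∀ j < N, dec j ∈ F) ∧ dec N = x := by
  classical
  have := hF.to_subtype
  obtain ⟨N, ⟨e⟩⟩ := Finite.exists_equiv_fin F
  refine ⟨N, fun p => if h : p ∈ F then e ⟨p, h⟩ else 0,
    fun j => if h : j < N then e.symm ⟨j, h⟩ else x, fun p hp => ?_, fun j hj => ?_, ?_⟩
  · simp [hp]
  · simp [hj]
  · simp

/-- Automata that accept the complement of `{x # xᴿ | init ++ output x = x}`, where `init` is `b`
repeated `m + 1` times followed by a fixed word. -/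
theorem exists_code [Finite S] [Finite B] (δ : S → B → S × List B) (s₀ : S) (b : B) (post : List B)
    (hpost : post ≠ []) :
    ∃ (k : ℕ) (f : ℕ → NIDDHPDACode) (e : Fin k ≃ Option B), Primrec f ∧
      ∀ m, ∃ L : Language (Fin k),
        (⟨k, L⟩ : Σ n, Language (Fin n)) = ⟨(f m).numSymbols, (f m).language⟩ ∧
        ∀ w, w ∈ L ↔ ¬ ∃ x ∈ {x | List.replicate (m + 1) b ++ post ++ QueueMachine.output δ s₀ x = x},
          w.map e = x.map some ++ none :: x.reverse.map some := by
  classical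
  obtain ⟨k, ⟨e'⟩⟩ := Finite.exists_equiv_fin (Option B)
  set e := e'.symm
  obtain ⟨F, hfin, hrun, hbad, hdone, hout, hnext⟩ := exists_finite_closed (withCopy δ) post
  -- `run (some s₀) post` already has a number below `N`; the second number `N` lets the chain `N +
  -- i` count down to it.
  obtain ⟨N, num, dec, hnum, hdec, hdecN⟩ := exists_numbering hfin (.run (some s₀) post)
  have hdecF : ∀ j ≤ N, dec j ∈ F := fun j hj => by
    rcases hj.lt_or_eq with h | rfl
    · exact hdec j h
    · exact hdecN ▸ hrun _
  have hpal : ∀ a : Option B, (State.run none []).next (withCopy δ) a ∈ F := by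
    rintro (_ | a)
    · exact hdone
    · exact hout none a
  set target : ℕ → Fin k → ℕ := fun j a => num ((dec j).next (withCopy δ) (e a))
  set startTarget : Fin k → ℕ := fun a => num ((State.run none []).next (withCopy δ) (e a))
  set accept : List ℕ := (List.range (N + 1)).filter fun j => dec j ≠ .done with haccept
  refine ⟨k, code N (fun j => (dec j).side) target (e' (some b)) (num .bad) startTarget accept, e,
    primrec_code _ _ _ _ _ _ _, fun m => ⟨_, rfl, ?_⟩⟩
  set M : NIDDHPDA (Fin (N + m + 1 + 1)) (Fin k) (Fin 0) :=
    (code N (fun j => (dec j).side) target (e' (some b)) (num .bad) startTarget accept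
    m).toNIDDHPDA
  -- The signature list is empty, and missing entries default to neutral.
  have hM : ∀ a, M.signature a = .neutral := fun a => rfl
  have hacc : ∀ q : Fin (N + m + 1 + 1), q ∈ M.accept ↔
      (q.val ≤ N ∧ dec q ≠ .done) ∨ N < q.val := by
    intro q
    change q.val ∈ accept ++ (List.range (m + 1)).map (fun i => N + i + 1) ↔ _
    rw [List.mem_append]
    refine or_congr (by simp [haccept]) ?_
    simp only [List.mem_map, List.mem_range]
    constructor
    · rintro ⟨i, -, h⟩
      omega
    · intro h
      exact ⟨q.val - (N + 1), by omega, by omega⟩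
  set chain : ℕ → State (Option S) B := fun i => .run (some s₀) (List.replicate i b ++ post)
    with hchain
  have hchainside : ∀ i, (chain i).side = .right := by
    intro i
    obtain ⟨c, t, rfl⟩ := List.exists_cons_of_ne_nil hpost
    cases i <;> rfl
  have hchainnext : ∀ i a, (chain (i + 1)).next (withCopy δ) (e a) =
      if a = e' (some b) then chain i else .bad := by
    intro i a
    have : e a = some b ↔ a = e' (some b) := e'.symm_apply_eq
    simp only [hchain, List.replicate_succ, List.cons_append, State.next, this]
  -- The bound `i < m` leaves out the initial state `N + m + 1`, the only one where both heads can
  -- move.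
  let R : Fin (N + m + 1 + 1) → State (Option S) B → Prop := fun q p =>
    (q.val ≤ N ∧ p = dec q) ∨ ∃ i < m, q.val = N + i + 1 ∧ p = chain (i + 1)
  have hRnum : ∀ p ∈ F, ∀ q : Fin (N + m + 1 + 1), q.val = num p → R q p := fun p hp q hq => by
    obtain ⟨h1, h2⟩ := hnum p hp
    exact .inl ⟨by omega, by rw [hq, h2]⟩
  have hRchain : ∀ i ≤ m, ∀ q : Fin (N + m + 1 + 1), q.val = N + i → R q (chain i) := by
    rintro (_ | i) hi q hq
    · exact .inl ⟨by omega, by rw [hq]; exact hdecN.symm⟩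
    · exact .inr ⟨i, by omega, hq, rfl⟩
  have hlt : ∀ p ∈ F, num p < N + m + 1 + 1 := fun p hp => by have := (hnum p hp).1; omega
  have hRif : ∀ i ≤ m, ∀ (a : Fin k) (q : Fin (N + m + 1 + 1)),
      q.val = (if a = e' (some b) then N + i else num .bad) →
      R q ((chain (i + 1)).next (withCopy δ) (e a)) := by
    intro i hi a q hq
    rw [hchainnext]
    split_ifs at hq ⊢ with h
    · exact hRchain i hi q hq
    · exact hRnum _ hbad q hq
  have hiflt : ∀ i ≤ m, ∀ a : Fin k,
      (if a = e' (some b) then N + i else num (.bad : State (Option S) B)) < N + m + 1 + 1 := by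
    intro i hi a
    split_ifs
    · omega
    · exact hlt _ hbad
  have main : ∀ {q p}, R q p → ∀ w, w ∈ M.acceptsFrom q ↔ w.map e ∉ p.words (withCopy δ) := by
    refine fun h => mem_acceptsFrom_iff hM e R ?_ ?_ ?_ h
    · intro q p h d a q' hq'
      rcases h with ⟨hq, rfl⟩ | ⟨i, hi, hq, rfl⟩ <;>
        rcases mem_neutralStep_code.1 hq' with ⟨h1, rfl, h3⟩ | ⟨j, hj, h1, rfl, h3⟩ | ⟨h1, h2, h3⟩
      · exact ⟨rfl, hRnum _ (hnext _ (hdecF _ hq) _) _ h3⟩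
      · omega
      · omega
      · omega
      · obtain rfl : i = j := by omega
        exact ⟨(hchainside _).symm, hRif i hj a q' h3⟩
      · omega
    · intro q p h a
      rcases h with ⟨hq, rfl⟩ | ⟨i, hi, hq, rfl⟩
      · exact ⟨⟨_, hlt _ (hnext _ (hdecF _ hq) (e a))⟩,
          mem_neutralStep_code.2 (.inl ⟨hq, rfl, rfl⟩)⟩
      · exact ⟨⟨_, hiflt i hi.le a⟩,
          mem_neutralStep_code.2 (.inr (.inl ⟨i, hi.le, hq, hchainside _, rfl⟩))⟩
    · intro q p h
      refine (hacc q).trans ?_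
      rcases h with ⟨hq, rfl⟩ | ⟨i, hi, hq, rfl⟩
      · simp [hq, hq.not_gt]
      · simp [hq, hchain, Nat.add_assoc]
  have hinit : M.init = Fin.last (N + m + 1) := by
    change Fin.ofNat (N + m + 1 + 1) (N + m + 1) = _
    exact Fin.ext (Nat.mod_eq_of_lt (Nat.lt_succ_self _))
  intro w
  change w ∈ M.acceptsFrom M.init ↔ _
  refine Iff.trans ?_ (not_congr (mem_words_copy_and (δ := δ) (s := s₀)
    (l := List.replicate (m + 1) b ++ post)))
  rw [hinit]
  refine mem_acceptsFrom_choice hM e (p₁ := .run none []) (p₂ := chain (m + 1)) rfl (by simp)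
    (hchainside _) ?_ (t₁ := fun a => ⟨startTarget a, hlt _ (hpal _)⟩)
    (t₂ := fun a => ⟨_, hiflt m le_rfl a⟩) ?_ ?_ ?_ ?_ w
  · rw [hacc]
    exact .inr (by simp)
  · intro a
    ext q'
    refine mem_neutralStep_code.trans ?_
    refine Iff.trans ?_ (Set.mem_singleton_iff.trans Fin.ext_iff).symm
    simp only [Fin.val_last, true_and, reduceCtorEq, false_and, and_false, exists_false, false_or]
    exact or_iff_right fun h => by omega
  · intro a
    ext q'
    refine mem_neutralStep_code.trans ?_
    refine Iff.trans ?_ (Set.mem_singleton_iff.trans Fin.ext_iff).symm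
    simp only [Fin.val_last, true_and, reduceCtorEq, false_and, and_false, or_false]
    constructor
    · rintro (⟨h, -⟩ | ⟨i, hi, h1, h2⟩)
      · omega
      · obtain rfl : i = m := by omega
        exact h2
    · exact fun h => .inr ⟨m, le_rfl, rfl, h⟩
  · exact fun a => main (hRnum _ (hpal _) _ rfl)
  · exact fun a => main (hRif m le_rfl a _ rfl)

end TwoHead

/-! ### Undecidability -/

theorem REPred.comp {α β : Type*} [Primcodable α] [Primcodable β] {p : β → Prop}
    (hp : REPred p) {f : α → β} (hf : Computable f) : REPred fun a => p (f a) :=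
  Partrec.comp hp hf

namespace TwoHead

theorem exists_primrec_log : ∃ g : ℕ → ℕ, Primrec g ∧ ∀ m, g (2 ^ (m + 1)) = m := by
  have hpow : Primrec₂ fun a b : ℕ => a ^ b := Primrec₂.unpaired'.1 Nat.Primrec.pow
  have hrel : PrimrecRel fun k m : ℕ => 2 ^ m = k :=
    Primrec.eq.comp₂ (hpow.comp₂ (Primrec₂.const 2) Primrec₂.right) Primrec₂.left
  refine ⟨fun k => (Nat.findGreatest (fun m => 2 ^ m = k) k).pred,
    Primrec.pred.comp (Primrec.nat_findGreatest Primrec.id hrel), fun m => ?_⟩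
  have h : 2 ^ Nat.findGreatest (fun i => 2 ^ i = 2 ^ (m + 1)) (2 ^ (m + 1)) = 2 ^ (m + 1) :=
    Nat.findGreatest_spec (P := fun i => 2 ^ i = 2 ^ (m + 1)) Nat.lt_two_pow_self.le rfl
  dsimp only
  rw [Nat.pow_right_injective le_rfl h]
  rfl

theorem isRegular_univ {A : Type*} {L : Language A} (hL : ∀ w, w ∈ L) : L.IsRegular :=
  ⟨Unit, inferInstance, ⟨fun _ _ => (), (), Set.univ⟩, by
    ext w
    simp [DFA.mem_accepts, hL]⟩

/-- There is a computable sequence of automata, with a common input alphabet, each of which is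
universal, and also regular, exactly if a program does not halt. -/
theorem exists_reduction : ∃ (k : ℕ) (f : Nat.Partrec.Code → NIDDHPDACode), Computable f ∧
    ∀ c, (f c).numSymbols = k ∧ ((f c).Universal ↔ ¬ (c.eval 0).Dom) ∧
      ((f c).Regular ↔ ¬ (c.eval 0).Dom) := by
  obtain ⟨g, hg, hg2⟩ := exists_primrec_log
  -- A universal function: at `2 ^ (m + 1)` it runs program number `m` on input `0`.
  have hpart : Partrec fun n : ℕ => (Denumerable.ofNat Nat.Partrec.Code (g n)).eval 0 :=
    Nat.Partrec.Code.eval_part.comp ((Computable.ofNat _).comp hg.to_comp) (.const 0)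
  obtain ⟨S, _, δ, s₀, hδ⟩ := StackQueue.exists_queueMachine hpart
  -- Three layers of `Option` are in play: the inner `none` ends a stack, the next one is the
  -- padding letter, and the outermost is the separator.
  obtain ⟨k, f, e, hf, hL⟩ := exists_code (QueueMachine.pad δ) s₀
    (some (some Turing.PartrecToTM2.Γ'.bit0))
    (([some .bit1, some .cons, none, none, none, none] :
      List (Option Turing.PartrecToTM2.Γ')).map some) (by simp)
  refine ⟨k, fun c => f (Encodable.encode c), hf.to_comp.comp .encode, fun c => ?_⟩
  set m := Encodable.encode c
  obtain ⟨L, hfL, hmem⟩ := hL m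
  have hdom : (c.eval 0).Dom ↔
      ∃ x, List.replicate (m + 1) (some (some Turing.PartrecToTM2.Γ'.bit0)) ++
        ([some .bit1, some .cons, none, none, none, none] :
          List (Option Turing.PartrecToTM2.Γ')).map some ++
        QueueMachine.output (QueueMachine.pad δ) s₀ x = x := by
    have := hδ (m + 1)
    rw [hg2, Denumerable.ofNat_encode, ← QueueMachine.exists_output_pad_iff] at this
    rw [this, List.map_append, List.map_replicate]
  have huniv : (∀ w, w ∈ L) ↔ ¬ (c.eval 0).Dom := by
    rw [hdom]
    constructor
    · rintro h ⟨x, hx⟩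
      exact (hmem ((x.map some ++ none :: x.reverse.map some).map e.symm)).1 (h _)
        ⟨x, hx, by rw [List.map_map, e.self_comp_symm, List.map_id]⟩
    · exact fun h w => (hmem w).2 fun ⟨x, hx, _⟩ => h ⟨x, hx⟩
  have hreg : L.IsRegular ↔ ¬ (c.eval 0).Dom := by
    refine ⟨fun h hd => ?_, fun h => isRegular_univ (huniv.2 h)⟩
    exact not_isRegular e (QueueMachine.infinite_setOf_output_pad (hdom.1 hd)) hmem h
  refine ⟨congrArg Sigma.fst hfL.symm, ?_, ?_⟩
  · rw [← huniv]
    -- As a property of the pair of alphabet size and language, universality transfers along `hfL`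
    -- without casts.
    change (fun z : Σ n, Language (Fin n) => ∀ w, w ∈ z.2) ⟨_, (f m).language⟩ ↔ _
    rw [← hfL]
  · rw [← hreg]
    change (fun z : Σ n, Language (Fin n) => z.2.IsRegular) ⟨_, (f m).language⟩ ↔ _
    rw [← hfL]

end TwoHead

theorem mainTheorem9 :
    (¬ REPred fun c : NIDDHPDACode => c.Universal) ∧
    (¬ REPred fun p : NIDDHPDACode × NIDDHPDACode => p.1.Equivalent p.2) ∧
    (¬ REPred fun c : NIDDHPDACode => c.Regular) := by
  obtain ⟨k, f, hf, hk⟩ := TwoHead.exists_reduction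
  have hhalt := ComputablePred.halting_problem_not_re 0
  refine ⟨fun h => hhalt ((h.comp hf).of_eq fun c => (hk c).2.1), fun h => ?_,
    fun h => hhalt ((h.comp hf).of_eq fun c => (hk c).2.2)⟩
  -- If every program halted, the set of non-halting ones would be empty, hence recursively
  -- enumerable.
  obtain ⟨u, hu⟩ : ∃ u : Nat.Partrec.Code, ¬ (u.eval 0).Dom := by
    by_contra hall
    push Not at hall
    exact hhalt ((Partrec.none (α := Nat.Partrec.Code) (σ := ℕ)).dom_re.of_eq fun c =>
      iff_of_false (fun h => h) (not_not.2 (hall c)))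
  refine hhalt ((h.comp (hf.pair (.const (f u)))).of_eq fun c => ?_)
  rw [← (hk c).2.1]
  have huniv : (f u).Universal := (hk u).2.1.2 hu
  constructor
  · rintro ⟨_, h⟩ w
    exact (h w).2 (huniv _)
  · exact fun h => ⟨(hk c).1.trans (hk u).1.symm, fun w => iff_of_true (h w) (huniv _)⟩
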